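/- Let $n\ge 1$ and let $\mathcal H_n=\{w=(z,t): z\in\mathbb C^n,\ t\in\mathbb R\}$ be the Heisenberg group with group law $$(z,t)(z',t')=\big(z+z',\ t+t'+2\,\mathrm{Im}\,(z\bar z')\big),\qquad z\bar z'=\sum_{j=1}^n z_j\overline{z_j'},$$ with Haar measure $dw=dz\,d\bar z\,dt$ normalised as $4^n\,dx\,dy\,dt$ (where $z=x+iy$), with $|w|=(|z|^4+t^2)^{1/4}$ and $d(w,w')=|w'^{-1}w|$. Theorem. Let $f\in\mathcal S(\mathcal H_n)$ be a complex-valued Schwartz function (that is, a Schwartz function on $\mathbb C^n\times\mathbb R\cong\mathbb R^{2n+1}$), let $0<\beta<1$ and $1\le p<2n/\beta$ with $p$ real. Then $$\int_{\mathcal H_n\times\mathcal H_n}\frac{|f(w)-f(w')|^p}{d(w,w')^{2n+2+p\beta}}\,dw\,dw'\ \ge\ F_{p,\beta}\int_{\mathcal H_n}|z|^{-p\beta}|f(w)|^p\,dw,$$ where, with $\lambda=(2n-p\beta)/p$ and any $\eta$ in the unit sphere $S^{2n-1}\subset\mathbb R^{2n}$, $$F_{p,\beta}=\frac{4^n\sqrt\pi\;\Gamma\!\left(\frac{2n+p\beta}{4}\right)}{\Gamma\!\left(\frac{2n+2+p\beta}{4}\right)}\int_{\mathbb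 R^{2n}}\big|1-|x|^{-\lambda}\big|^p\,|x-\eta|^{-2n-p\beta}\,dx .$$ -/

import Mathlib

open MeasureTheory
open scoped NNReal ENNReal ComplexConjugate

noncomputable section

/-- The underlying manifold `ℂⁿ × ℝ` of the Heisenberg group, with points `w = (z, t)`. The
additive (normed vector space) structure is the Euclidean one and is only used to speak about
Schwartz functions and Lebesgue measure; the Heisenberg group law is the multiplication below. -/
def Heisenberg (n : ℕ) : Type := EuclideanSpace ℂ (Fin n) × ℝ

namespace Heisenberg

instance (n : ℕ) : NormedAddCommGroup (Heisenberg n) :=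
  inferInstanceAs (NormedAddCommGroup (EuclideanSpace ℂ (Fin n) × ℝ))

instance (n : ℕ) : NormedSpace ℝ (Heisenberg n) :=
  inferInstanceAs (NormedSpace ℝ (EuclideanSpace ℂ (Fin n) × ℝ))

/-- Lebesgue measure `dx dy dt` on `ℂⁿ × ℝ`, where `z = x + iy`. -/
instance (n : ℕ) : MeasureSpace (Heisenberg n) :=
  inferInstanceAs (MeasureSpace (EuclideanSpace ℂ (Fin n) × ℝ))

instance (n : ℕ) : BorelSpace (Heisenberg n) :=
  inferInstanceAs (BorelSpace (EuclideanSpace ℂ (Fin n) × ℝ))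

instance (n : ℕ) : SigmaFinite (volume : Measure (Heisenberg n)) :=
  inferInstanceAs (SigmaFinite (volume : Measure (EuclideanSpace ℂ (Fin n) × ℝ)))

/-- The component `z ∈ ℂⁿ` of `w = (z, t)`. -/
def z {n : ℕ} (w : Heisenberg n) : EuclideanSpace ℂ (Fin n) := Prod.fst w

/-- The component `t ∈ ℝ` of `w = (z, t)`. -/
def t {n : ℕ} (w : Heisenberg n) : ℝ := Prod.snd w

/-- The point `(z, t)`. -/
def mk {n : ℕ} (z : EuclideanSpace ℂ (Fin n)) (t : ℝ) : Heisenberg n := Prod.mk z t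

/-- `Im (z z̄')`, where `z z̄' = ∑ j, z_j * conj z'_j`. -/
def imForm {n : ℕ} (z z' : EuclideanSpace ℂ (Fin n)) : ℝ :=
  (∑ j, z j * conj (z' j)).im

/-- `(z, t) (z', t') = (z + z', t + t' + 2 Im (z z̄'))`. -/
instance (n : ℕ) : Mul (Heisenberg n) :=
  ⟨fun w w' => mk (w.z + w'.z) (w.t + w'.t + 2 * imForm w.z w'.z)⟩

instance (n : ℕ) : One (Heisenberg n) := ⟨mk 0 0⟩

instance (n : ℕ) : Inv (Heisenberg n) := ⟨fun w => mk (-w.z) (-w.t)⟩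

theorem imForm_add_left {n : ℕ} (a b c : EuclideanSpace ℂ (Fin n)) :
    imForm (a + b) c = imForm a c + imForm b c := by
  simp [imForm, add_mul, Finset.sum_add_distrib]
  try ring

theorem imForm_add_right {n : ℕ} (a b c : EuclideanSpace ℂ (Fin n)) :
    imForm a (b + c) = imForm a b + imForm a c := by
  simp [imForm, mul_add, Finset.sum_add_distrib]
  try ring

theorem imForm_zero_left {n : ℕ} (a : EuclideanSpace ℂ (Fin n)) : imForm 0 a = 0 := by
  simp [imForm]

theorem imForm_zero_right {n : ℕ} (a : EuclideanSpace ℂ (Fin n)) : imForm a 0 = 0 := by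
  simp [imForm]

theorem imForm_neg_self {n : ℕ} (a : EuclideanSpace ℂ (Fin n)) : imForm (-a) a = 0 := by
  simp [imForm, mul_comm]

/-- The Heisenberg group. -/
instance (n : ℕ) : Group (Heisenberg n) :=
  Group.ofLeftAxioms
    (fun a b c => by
      change mk (a.z + b.z + c.z)
          (a.t + b.t + 2 * imForm a.z b.z + c.t + 2 * imForm (a.z + b.z) c.z) =
        mk (a.z + (b.z + c.z))
          (a.t + (b.t + c.t + 2 * imForm b.z c.z) + 2 * imForm a.z (b.z + c.z))
      rw [imForm_add_left, imForm_add_right, add_assoc a.z]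
      congr 1
      ring)
    (fun a => by
      change mk (0 + a.z) (0 + a.t + 2 * imForm 0 a.z) = mk a.z a.t
      rw [imForm_zero_left]
      simp)
    (fun a => by
      change mk (-a.z + a.z) (-a.t + a.t + 2 * imForm (-a.z) a.z) = mk 0 0
      rw [imForm_neg_self]
      simp)

/-- Haar measure `dw = dz dz̄ dt`, normalised as `4ⁿ dx dy dt`. -/
def haar (n : ℕ) : Measure (Heisenberg n) := ((4 : ℝ≥0) ^ n) • (volume : Measure (Heisenberg n))

/-- The homogeneous norm `|w| = (|z|⁴ + t²)^(1/4)`. -/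
def gauge {n : ℕ} (w : Heisenberg n) : ℝ := (‖w.z‖ ^ 4 + w.t ^ 2) ^ (1 / 4 : ℝ)

/-- The metric `d(w, w') = |w'⁻¹ w|`. -/
def d {n : ℕ} (w w' : Heisenberg n) : ℝ := gauge (w'⁻¹ * w)

/-- The constant `F_{p,β}`, as an extended non-negative number, with `η` a point of the unit
sphere of `ℝ²ⁿ`. -/
def constF (n : ℕ) (p β : ℝ) (η : EuclideanSpace ℝ (Fin (2 * n))) : ℝ≥0∞ :=
  ENNReal.ofReal
      (4 ^ n * √Real.pi * Real.Gamma ((2 * n + p * β) / 4) /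
        Real.Gamma ((2 * n + 2 + p * β) / 4)) *
    ∫⁻ x : EuclideanSpace ℝ (Fin (2 * n)),
      ENNReal.ofReal
        (|1 - ‖x‖ ^ (-((2 * n - p * β) / p))| ^ p * ‖x - η‖ ^ (-(2 * n) - p * β))

end Heisenberg

end

open Set Metric Module

/-! ### Changes of variable and Minkowski's inequality for `∫⁻` -/

section Tools

/-! The inequality is a reverse triangle inequality applied on each dilation slice. Put `N = 2n`, `α
= pβ` and write the second point as `z' = ρ‖z‖θ` with `‖θ‖ = 1`. For fixed `ρ`, regard `f(z, t)` and
`f(z', t')` as two functions of `(z, t, θ, t')` in one weighted `L^p` space, whose weight is the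
kernel `d^(-N-2-α)` times the Jacobian.

Both norms can be computed exactly. The Heisenberg twist only translates the central variable, so
integrating out `t'` or `t` leaves the Euclidean kernel `C‖z - z'‖^(-N-α)`, with `C` a Beta integral
(`lintegral_distKernel_right`, `lintegral_distKernel_left`). Rotation invariance and homogeneity
then give `M = C ρ^(N-1) Φ(ρ) S` for the `p`-th power of the first norm, and `ρ^(α-N) M` for that of
the second. Here `S` is the Hardy integral and `Φ(ρ)` the integral of `‖η - ρθ‖^(-N-α)` over the
sphere (`lintegral_fst_dilationKernel`, `lintegral_snd_dilationKernel`).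

Minkowski bounds the slice of the double integral below by `|1 - ρ^(-(N-α)/p)|^p M`. Integrating
over `ρ` gives `C S` times the integral defining the sharp constant, written in polar coordinates
(`fractional_hardy_of_marginals`). -/

theorem lintegral_Ioi_comp_mul_left (g : ℝ → ℝ≥0∞) {c : ℝ} (hc : 0 < c) :
    ∫⁻ r in Ioi 0, g r = ENNReal.ofReal c * ∫⁻ r in Ioi 0, g (c * r) := by
  have hemb : MeasurableEmbedding (fun x : ℝ => c * x) :=
    (Homeomorph.mulLeft₀ c hc.ne').measurableEmbedding
  have h := Real.smul_map_volume_mul_left hc.ne'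
  conv_lhs => rw [← lintegral_indicator measurableSet_Ioi, ← h]
  rw [lintegral_smul_measure, hemb.lintegral_map, abs_of_pos hc, smul_eq_mul,
    ← lintegral_indicator measurableSet_Ioi]
  congr 2 with x
  simp [indicator, hc]

/-- Minkowski after absorbing `w ^ (1 / p)` into each function. The hypothesis `a ≤ b + d` avoids
truncated subtraction, so both directions of the reverse triangle inequality follow. -/
theorem ENNReal.le_lintegral_Lp_sub {X : Type*} [MeasurableSpace X] (μ : Measure X) {p : ℝ}
    (hp : 1 ≤ p) (w a b d : X → ℝ≥0∞) (hw : Measurable w)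
    (hb : Measurable b) (hd : Measurable d) (h : ∀ x, a x ≤ b x + d x) :
    (∫⁻ x, a x ^ p * w x ∂μ) ^ (1 / p) ≤
      (∫⁻ x, b x ^ p * w x ∂μ) ^ (1 / p) + (∫⁻ x, d x ^ p * w x ∂μ) ^ (1 / p) := by
  have hp0 : 0 < p := by linarith
  have key : ∀ g : X → ℝ≥0∞, ∀ x, g x ^ p * w x = (g x * w x ^ (1 / p)) ^ p := fun g x => by
    rw [ENNReal.mul_rpow_of_nonneg _ _ hp0.le, ← ENNReal.rpow_mul, one_div,
      inv_mul_cancel₀ hp0.ne', ENNReal.rpow_one]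
  simp_rw [key]
  refine le_trans ?_ (ENNReal.lintegral_Lp_add_le (μ := μ) (by fun_prop) (by fun_prop) hp)
  gcongr with x
  simp only [Pi.add_apply]
  rw [← add_mul]
  gcongr
  exact h x

/-- The `p`-th power form of the reverse triangle inequality, for two functions whose norms are
`M ^ (1 / p)` and `m * M ^ (1 / p)`. -/
theorem ENNReal.abs_one_sub_rpow_mul_le {p m : ℝ} (hp : 1 ≤ p) (hm : 0 ≤ m) {M D : ℝ≥0∞}
    (hM : M ≠ ∞)
    (h1 : M ^ (1 / p) ≤ (ENNReal.ofReal (m ^ p) * M) ^ (1 / p) + D ^ (1 / p))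
    (h2 : (ENNReal.ofReal (m ^ p) * M) ^ (1 / p) ≤ M ^ (1 / p) + D ^ (1 / p)) :
    ENNReal.ofReal (|1 - m| ^ p) * M ≤ D := by
  have hp0 : 0 < p := by linarith
  have hp1 : 0 ≤ 1 / p := by positivity
  by_cases hD : D = ∞
  · simp [hD]
  have e : ∀ y : ℝ, 0 ≤ y → (ENNReal.ofReal (y ^ p) * M) ^ (1 / p) =
      ENNReal.ofReal y * M ^ (1 / p) := fun y hy => by
    rw [ENNReal.mul_rpow_of_nonneg _ _ hp1, ENNReal.ofReal_rpow_of_nonneg (by positivity) hp1,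
      ← Real.rpow_mul hy, mul_one_div_cancel hp0.ne', Real.rpow_one]
  suffices h : (ENNReal.ofReal (|1 - m| ^ p) * M) ^ (1 / p) ≤ D ^ (1 / p) from
    (ENNReal.rpow_le_rpow_iff (by positivity)).1 h
  rw [e _ hm] at h1 h2
  rw [e _ (abs_nonneg _)]
  have hx : M ^ (1 / p) ≠ ∞ := ENNReal.rpow_ne_top_of_nonneg hp1 hM
  have hd : D ^ (1 / p) ≠ ∞ := ENNReal.rpow_ne_top_of_nonneg hp1 hD
  lift M ^ (1 / p) to ℝ≥0 using hx with x
  lift D ^ (1 / p) to ℝ≥0 using hd with d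
  lift m to ℝ≥0 using hm
  rw [ENNReal.ofReal_coe_nnreal] at h1 h2
  rw [ENNReal.ofReal, ← ENNReal.coe_mul, ENNReal.coe_le_coe, ← NNReal.coe_le_coe]
  norm_cast at h1 h2
  rw [← NNReal.coe_le_coe] at h1 h2
  push_cast at h1 h2 ⊢
  rw [Real.coe_toNNReal _ (abs_nonneg _)]
  rcases abs_cases (1 - (m : ℝ)) with ⟨h, _⟩ | ⟨h, _⟩ <;> rw [h] <;> nlinarith

end Tools

/-! ### Polar coordinates and rotation invariance of the sphere measure -/

section Polar

variable {E : Type*} [NormedAddCommGroup E] [InnerProductSpace ℝ E] [FiniteDimensional ℝ E]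
  [MeasurableSpace E] [BorelSpace E]

theorem lintegral_polar [Nontrivial E] (F : E → ℝ≥0∞) (hF : Measurable F) :
    ∫⁻ x, F x = ∫⁻ r in Ioi (0 : ℝ), ENNReal.ofReal (r ^ (finrank ℝ E - 1)) *
      ∫⁻ θ : sphere (0 : E) 1, F (r • (θ : E)) ∂(volume : Measure E).toSphere := by
  calc ∫⁻ x, F x = ∫⁻ x : ({(0)}ᶜ : Set E), F x.1 ∂((volume : Measure E).comap (↑)) := by
        rw [lintegral_subtype_comap (measurableSet_singleton _).compl F,
          restrict_compl_singleton]
    _ = ∫⁻ x, F (x.2.1 • x.1.1) ∂(volume : Measure E).toSphere.prod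
          (.volumeIoiPow (finrank ℝ E - 1)) := by
        rw [← ((volume : Measure E).measurePreserving_homeomorphUnitSphereProd).lintegral_comp_emb
          (Homeomorph.measurableEmbedding _)]
        refine lintegral_congr fun x => ?_
        have hx : ‖(x : E)‖ ≠ 0 := norm_ne_zero_iff.2 x.2
        simp [smul_smul, hx]
    _ = _ := by
        rw [lintegral_prod_symm _ (by fun_prop), Measure.volumeIoiPow,
          lintegral_withDensity_eq_lintegral_mul _ (by fun_prop),
          ← lintegral_subtype_comap measurableSet_Ioi]
        · rfl
        · refine Measurable.lintegral_prod_right ?_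
          fun_prop

theorem lintegral_comp_smul (F : E → ℝ≥0∞) {r : ℝ} (hr : 0 < r) :
    ∫⁻ x, F (r • x) = ENNReal.ofReal ((r ^ finrank ℝ E)⁻¹) * ∫⁻ x, F x := by
  have hemb : MeasurableEmbedding (fun x : E => r • x) :=
    (Homeomorph.smulOfNeZero r hr.ne').measurableEmbedding
  rw [← hemb.lintegral_map, Measure.map_addHaar_smul _ hr.ne', lintegral_smul_measure,
    abs_of_pos (by positivity), smul_eq_mul]

/-- Invariance is inherited from Lebesgue measure: the function `x ↦ 1_{‖x‖<1} h(x/‖x‖)` has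
integral `c` times the sphere integral of `h`, and `c = 1 / dim E` is neither `0` nor `∞`, so it
cancels. -/
theorem lintegral_sphere_comp_isometry [Nontrivial E] (R : E ≃ₗᵢ[ℝ] E) (h : E → ℝ≥0∞)
    (hh : Measurable h) :
    ∫⁻ θ : sphere (0 : E) 1, h (R θ) ∂(volume : Measure E).toSphere =
      ∫⁻ θ : sphere (0 : E) 1, h θ ∂(volume : Measure E).toSphere := by
  have hRm : Measurable R := R.continuous.measurable
  set c : ℝ≥0∞ := ∫⁻ r in Ioi (0 : ℝ), ENNReal.ofReal (r ^ (finrank ℝ E - 1)) *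
    (Iio (1 : ℝ)).indicator 1 r with hc
  have hce : c = ENNReal.ofReal (1 / finrank ℝ E) := by
    have hN : 0 < finrank ℝ E := finrank_pos
    have h0 : c = ∫⁻ r in Ioc (0 : ℝ) 1, ENNReal.ofReal (r ^ (finrank ℝ E - 1)) := by
      rw [hc, ← Measure.restrict_congr_set Ioo_ae_eq_Ioc, ← lintegral_indicator measurableSet_Ioi,
        ← lintegral_indicator measurableSet_Ioo]
      congr 1 with r
      by_cases h1 : 0 < r <;> by_cases h2 : r < 1 <;> simp [indicator, h1, h2]
    rw [h0, ← ofReal_integral_eq_lintegral_ofReal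
      (intervalIntegral.intervalIntegrable_pow _).1, ← intervalIntegral.integral_of_le zero_le_one,
      integral_pow]
    · simp [Nat.cast_pred hN]
    · filter_upwards [ae_restrict_mem measurableSet_Ioc] with y hy
      exact pow_nonneg hy.1.le _
  have hN : (0 : ℝ) < finrank ℝ E := by exact_mod_cast finrank_pos
  have hc0 : c ≠ 0 := by rw [hce]; simpa using finrank_pos.ne'
  have hct : c ≠ ∞ := by rw [hce]; simp
  have key : ∀ g : E → ℝ≥0∞, Measurable g →
      ∫⁻ x : E, (Iio (1 : ℝ)).indicator 1 ‖x‖ * g (‖x‖⁻¹ • x) =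
        c * ∫⁻ θ : sphere (0 : E) 1, g θ ∂(volume : Measure E).toSphere := fun g hg => by
    have hi : Measurable ((Iio (1 : ℝ)).indicator (1 : ℝ → ℝ≥0∞)) :=
      measurable_one.indicator measurableSet_Iio
    rw [lintegral_polar _ (by fun_prop), hc, ← lintegral_mul_const _ (by fun_prop)]
    refine setLIntegral_congr_fun measurableSet_Ioi fun r hr => ?_
    have hr' : (0 : ℝ) < r := hr
    simp only [norm_smul, norm_eq_of_mem_sphere, mul_one, Real.norm_eq_abs, abs_of_pos hr',
      smul_smul, inv_mul_cancel₀ hr'.ne', one_smul]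
    rw [lintegral_const_mul _ (by fun_prop), mul_assoc]
  have := R.measurePreserving.lintegral_comp_emb R.toHomeomorph.measurableEmbedding
    (fun x : E => (Iio (1 : ℝ)).indicator 1 ‖x‖ * h (‖x‖⁻¹ • x))
  rw [key h hh] at this
  simp only [R.norm_map, ← map_smul] at this
  rw [key (fun x => h (R x)) (by fun_prop)] at this
  exact (ENNReal.mul_right_inj hc0 hct).1 this

theorem lintegral_sphere_norm_sub_congr [Nontrivial E] (g : ℝ → ℝ≥0∞) (hg : Measurable g) (ρ : ℝ)
    {φ η : E} (h : ‖φ‖ = ‖η‖) :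
    ∫⁻ θ : sphere (0 : E) 1, g ‖φ - ρ • (θ : E)‖ ∂(volume : Measure E).toSphere =
      ∫⁻ θ : sphere (0 : E) 1, g ‖η - ρ • (θ : E)‖ ∂(volume : Measure E).toSphere := by
  -- Vectors of equal norm are exchanged by the reflection in the hyperplane orthogonal to their
  -- difference.
  obtain ⟨R, rfl⟩ : ∃ R : E ≃ₗᵢ[ℝ] E, R φ = η := ⟨_, Submodule.reflection_sub h⟩
  rw [← lintegral_sphere_comp_isometry R (fun θ => g ‖R φ - ρ • θ‖) (by fun_prop)]
  simp_rw [← map_smul, ← map_sub, R.norm_map]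

end Polar

/-! ### The sharp Hardy inequality for kernels with homogeneous marginals -/

section Hardy

theorem ne_smul_of_mem_sphere {E : Type*} [NormedAddCommGroup E]
    [InnerProductSpace ℝ E] {z : E} (hz : z ≠ 0) {ρ : ℝ} (hρ : 0 < ρ) (hρ1 : ρ ≠ 1)
    (θ : sphere (0 : E) 1) : z ≠ (ρ * ‖z‖) • (θ : E) := by
  intro h
  have hz' : 0 < ‖z‖ := norm_pos_iff.2 hz
  have := congrArg norm h
  rw [norm_smul, norm_eq_of_mem_sphere, mul_one, Real.norm_eq_abs, abs_of_pos (by positivity)]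
    at this
  apply hρ1
  field_simp at this
  exact this.symm

variable {E : Type*} [NormedAddCommGroup E] [InnerProductSpace ℝ E] [FiniteDimensional ℝ E]
  [MeasurableSpace E] [BorelSpace E] {T : Type*} [MeasurableSpace T]

/-- The integral of `‖η - ρ θ‖ ^ e` over `θ` in the unit sphere. -/
noncomputable def sphereKernel (η : E) (e ρ : ℝ) : ℝ≥0∞ :=
  ∫⁻ θ : sphere (0 : E) 1, ENNReal.ofReal (‖η - ρ • (θ : E)‖ ^ e) ∂(volume : Measure E).toSphere

/-- Off `ρ = 1` the integrand is bounded, because `‖η - ρθ‖ ≥ |1 - ρ|`. -/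
theorem sphereKernel_ne_top {η : E} (hη : ‖η‖ = 1) {e ρ : ℝ} (he : e ≤ 0) (hρ : 0 < ρ)
    (hρ1 : ρ ≠ 1) : sphereKernel η e ρ ≠ ∞ := by
  refine ne_top_of_le_ne_top ?_ (lintegral_mono (g := fun _ => ENNReal.ofReal (|1 - ρ| ^ e))
    fun θ => ENNReal.ofReal_le_ofReal ?_)
  · rw [lintegral_const]
    exact ENNReal.mul_ne_top ENNReal.ofReal_ne_top (measure_ne_top _ _)
  · refine Real.rpow_le_rpow_of_nonpos (abs_pos.2 (sub_ne_zero.2 hρ1.symm)) ?_ he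
    have := abs_norm_sub_norm_le η (ρ • (θ : E))
    simpa [norm_smul, hη, abs_of_pos hρ] using this

theorem lintegral_sphere_norm_sub_rpow [Nontrivial E] {η : E} (hη : ‖η‖ = 1) (e ρ : ℝ) {z : E}
    (hz : z ≠ 0) :
    ∫⁻ θ : sphere (0 : E) 1, ENNReal.ofReal (‖z - (ρ * ‖z‖) • (θ : E)‖ ^ e)
        ∂(volume : Measure E).toSphere =
      ENNReal.ofReal (‖z‖ ^ e) * sphereKernel η e ρ := by
  have hz' : ‖z‖ ≠ 0 := norm_ne_zero_iff.2 hz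
  rw [sphereKernel, ← lintegral_sphere_norm_sub_congr (fun x => ENNReal.ofReal (x ^ e))
    (by fun_prop) ρ (φ := ‖z‖⁻¹ • z) (by simp [norm_smul, hz', hη]),
    ← lintegral_const_mul _ (by fun_prop)]
  refine lintegral_congr fun θ => ?_
  rw [← ENNReal.ofReal_mul (by positivity), ← Real.mul_rpow (by positivity) (by positivity)]
  congr 2
  conv_rhs => rw [← norm_norm z, ← norm_smul, norm_norm, smul_sub, smul_smul, smul_smul,
    mul_inv_cancel₀ hz', one_smul, mul_comm ‖z‖]

/-- Here the direction of the first point varies. Since `‖φ - ρθ‖ = ‖θ - ρφ‖` for unit vectors, the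
roles of `φ` and `θ` can be exchanged. -/
theorem lintegral_sphere_norm_sub_rpow' [Nontrivial E] {η : E} (hη : ‖η‖ = 1) (e ρ : ℝ) {r : ℝ}
    (hr : 0 < r) (θ : sphere (0 : E) 1) :
    ∫⁻ φ : sphere (0 : E) 1, ENNReal.ofReal (‖r • (φ : E) - (ρ * r) • (θ : E)‖ ^ e)
        ∂(volume : Measure E).toSphere =
      ENNReal.ofReal (r ^ e) * sphereKernel η e ρ := by
  have hz : r • (θ : E) ≠ 0 := smul_ne_zero hr.ne' (ne_zero_of_mem_unit_sphere θ)
  have h := lintegral_sphere_norm_sub_rpow hη e ρ hz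
  have hn : ‖r • (θ : E)‖ = r := by simp [norm_smul, abs_of_pos hr]
  rw [hn] at h
  rw [← h]
  refine lintegral_congr fun φ => ?_
  congr 2
  rw [← sq_eq_sq₀ (norm_nonneg _) (norm_nonneg _), norm_sub_sq_real, norm_sub_sq_real]
  simp only [norm_smul, inner_smul_left, inner_smul_right, real_inner_comm (φ : E) (θ : E),
    norm_eq_of_mem_sphere, conj_trivial]

/-- Polar coordinates for `z'`, with radius `ρ‖z‖`: the radial measure becomes `ρ^(N-1) ‖z‖^N dρ`.
Tonelli then moves `ρ` outermost; the points with `z = 0` are null. -/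
theorem lintegral_lintegral_dilation [Nontrivial E] (ν : Measure T) [SigmaFinite ν]
    (G : E × T → E × T → ℝ≥0∞) (hG : Measurable (Function.uncurry G)) :
    ∫⁻ q, ∫⁻ q', G q q' ∂(volume.prod ν) ∂((volume : Measure E).prod ν) =
      ∫⁻ ρ in Ioi (0 : ℝ), ∫⁻ x : (E × T) × (sphere (0 : E) 1 × T),
        G x.1 ((ρ * ‖x.1.1‖) • (x.2.1 : E), x.2.2) *
          ENNReal.ofReal (ρ ^ (finrank ℝ E - 1) * ‖x.1.1‖ ^ finrank ℝ E)
        ∂(((volume : Measure E).prod ν).prod ((volume : Measure E).toSphere.prod ν)) := by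
  have hN : 0 < finrank ℝ E := finrank_pos
  have hG' : Measurable fun x : (E × T) × (E × T) => G x.1 x.2 := hG
  have hz : ∀ᵐ q ∂((volume : Measure E).prod ν), q.1 ≠ 0 :=
    Measure.quasiMeasurePreserving_fst.ae (Measure.ae_ne volume (0 : E))
  have hm : Measurable fun y : (E × T) × ℝ × (sphere (0 : E) 1 × T) =>
      G y.1 ((y.2.1 * ‖y.1.1‖) • (y.2.2.1 : E), y.2.2.2) *
          ENNReal.ofReal (y.2.1 ^ (finrank ℝ E - 1) * ‖y.1.1‖ ^ finrank ℝ E) := by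
    refine Measurable.mul ?_ (by fun_prop)
    exact hG'.comp (f := fun y : (E × T) × ℝ × (sphere (0 : E) 1 × T) =>
      (y.1, ((y.2.1 * ‖y.1.1‖) • (y.2.2.1 : E), y.2.2.2))) (by fun_prop)
  have hm2 : Measurable fun y : ((E × T) × ℝ) × (sphere (0 : E) 1 × T) =>
      G y.1.1 ((y.1.2 * ‖y.1.1.1‖) • (y.2.1 : E), y.2.2) *
          ENNReal.ofReal (y.1.2 ^ (finrank ℝ E - 1) * ‖y.1.1.1‖ ^ finrank ℝ E) :=
    hm.comp (g := fun y : (E × T) × ℝ × (sphere (0 : E) 1 × T) =>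
      G y.1 ((y.2.1 * ‖y.1.1‖) • (y.2.2.1 : E), y.2.2.2) *
          ENNReal.ofReal (y.2.1 ^ (finrank ℝ E - 1) * ‖y.1.1‖ ^ finrank ℝ E))
      (f := fun y : ((E × T) × ℝ) × (sphere (0 : E) 1 × T) => (y.1.1, (y.1.2, y.2)))
      (by fun_prop)
  have inner : ∀ q : E × T, q.1 ≠ 0 → ∫⁻ q', G q q' ∂(volume.prod ν) =
      ∫⁻ ρ in Ioi (0 : ℝ), ∫⁻ y : sphere (0 : E) 1 × T,
        G q ((ρ * ‖q.1‖) • (y.1 : E), y.2) *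
          ENNReal.ofReal (ρ ^ (finrank ℝ E - 1) * ‖q.1‖ ^ finrank ℝ E)
        ∂((volume : Measure E).toSphere.prod ν) := by
    intro q hq
    have hq' : 0 < ‖q.1‖ := norm_pos_iff.2 hq
    have h1 : Measurable fun q' => G q q' := hG'.comp (f := fun q' : E × T => (q, q')) (by fun_prop)
    rw [lintegral_prod _ h1.aemeasurable,
      lintegral_polar _ (Measurable.lintegral_prod_right' h1),
      lintegral_Ioi_comp_mul_left _ hq', ← lintegral_const_mul']
    swap
    · exact ENNReal.ofReal_ne_top
    refine setLIntegral_congr_fun measurableSet_Ioi fun ρ hρ => ?_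
    have hρ' : (0 : ℝ) < ρ := hρ
    have h2 : Measurable fun y : sphere (0 : E) 1 × T => G q ((ρ * ‖q.1‖) • (y.1 : E), y.2) :=
      h1.comp (f := fun y : sphere (0 : E) 1 × T => ((ρ * ‖q.1‖) • (y.1 : E), y.2)) (by fun_prop)
    rw [lintegral_mul_const _ h2, lintegral_prod _ h2.aemeasurable, ← mul_assoc,
      ← ENNReal.ofReal_mul hq'.le, mul_comm]
    congr 1
    · rw [mul_comm ρ]
    · congr 1
      rw [mul_pow, mul_left_comm, ← mul_assoc, mul_comm, ← mul_assoc]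
      conv_rhs => rw [← Nat.sub_add_cancel hN, pow_succ]
      simp only [Nat.add_sub_cancel]
      ring
  calc _ = ∫⁻ q, (∫⁻ ρ in Ioi (0 : ℝ), ∫⁻ y : sphere (0 : E) 1 × T,
        G q ((ρ * ‖q.1‖) • (y.1 : E), y.2) *
          ENNReal.ofReal (ρ ^ (finrank ℝ E - 1) * ‖q.1‖ ^ finrank ℝ E)
        ∂((volume : Measure E).toSphere.prod ν)) ∂((volume : Measure E).prod ν) :=
      lintegral_congr_ae (hz.mono inner)
    _ = _ := by
      rw [lintegral_lintegral_swap]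
      · refine lintegral_congr fun ρ => ?_
        have hmρ : Measurable fun x : (E × T) × (sphere (0 : E) 1 × T) =>
            G x.1 ((ρ * ‖x.1.1‖) • (x.2.1 : E), x.2.2) *
              ENNReal.ofReal (ρ ^ (finrank ℝ E - 1) * ‖x.1.1‖ ^ finrank ℝ E) :=
          hm.comp (g := fun y : (E × T) × ℝ × (sphere (0 : E) 1 × T) =>
            G y.1 ((y.2.1 * ‖y.1.1‖) • (y.2.2.1 : E), y.2.2.2) *
              ENNReal.ofReal (y.2.1 ^ (finrank ℝ E - 1) * ‖y.1.1‖ ^ finrank ℝ E))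
            (f := fun x : (E × T) × (sphere (0 : E) 1 × T) => (x.1, (ρ, x.2))) (by fun_prop)
        exact (lintegral_prod _ hmρ.aemeasurable).symm
      · exact (Measurable.lintegral_prod_right' hm2).aemeasurable

/-- The kernel `W (z, t) ((ρ ‖z‖) θ, t')` with the Jacobian of `z' = (ρ ‖z‖) θ`. -/
noncomputable def dilationKernel (W : E × T → E × T → ℝ≥0∞) (ρ : ℝ)
    (x : (E × T) × (sphere (0 : E) 1 × T)) : ℝ≥0∞ :=
  W x.1 ((ρ * ‖x.1.1‖) • (x.2.1 : E), x.2.2) *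
    ENNReal.ofReal (ρ ^ (finrank ℝ E - 1) * ‖x.1.1‖ ^ finrank ℝ E)

theorem measurable_dilationKernel {W : E × T → E × T → ℝ≥0∞}
    (hW : Measurable (Function.uncurry W)) (ρ : ℝ) : Measurable (dilationKernel W ρ) := by
  refine Measurable.mul ?_ (by fun_prop)
  exact hW.comp (f := fun x : (E × T) × (sphere (0 : E) 1 × T) =>
    (x.1, ((ρ * ‖x.1.1‖) • (x.2.1 : E), x.2.2))) (by fun_prop)

variable {ν : Measure T} [SigmaFinite ν] {W : E × T → E × T → ℝ≥0∞} {C : ℝ≥0∞} {α : ℝ}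

/-- Integrate `t'`, then `θ`; the factor `‖z‖^(-N-α)` so produced meets the Jacobian `‖z‖^N` and
leaves `‖z‖^(-α)`. -/
theorem lintegral_fst_dilationKernel [Nontrivial E] (hW : Measurable (Function.uncurry W))
    (h1 : ∀ z z', z ≠ z' → ∀ t, ∫⁻ t', W (z, t) (z', t') ∂ν =
      C * ENNReal.ofReal (‖z - z'‖ ^ (-(finrank ℝ E : ℝ) - α)))
    {η : E} (hη : ‖η‖ = 1) {ρ : ℝ} (hρ : 0 < ρ) (hρ1 : ρ ≠ 1)
    (u : E × T → ℝ≥0∞) (hu : Measurable u) :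
    ∫⁻ x, u x.1 * dilationKernel W ρ x
        ∂(((volume : Measure E).prod ν).prod ((volume : Measure E).toSphere.prod ν)) =
      C * ENNReal.ofReal (ρ ^ (finrank ℝ E - 1)) *
        sphereKernel η (-(finrank ℝ E : ℝ) - α) ρ *
        ∫⁻ q, ENNReal.ofReal (‖q.1‖ ^ (-α)) * u q ∂((volume : Measure E).prod ν) := by
  have hd := measurable_dilationKernel hW ρ
  have hz : ∀ᵐ q ∂((volume : Measure E).prod ν), q.1 ≠ 0 :=
    Measure.quasiMeasurePreserving_fst.ae (Measure.ae_ne volume (0 : E))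
  rw [lintegral_prod _ (by fun_prop), ← lintegral_const_mul _ (by fun_prop)]
  refine lintegral_congr_ae (hz.mono fun q hq => ?_)
  have hq' : 0 < ‖q.1‖ := norm_pos_iff.2 hq
  have hm : Measurable fun y : sphere (0 : E) 1 × T => W q ((ρ * ‖q.1‖) • (y.1 : E), y.2) :=
    hW.comp (f := fun y : sphere (0 : E) 1 × T => (q, ((ρ * ‖q.1‖) • (y.1 : E), y.2)))
      (by fun_prop)
  simp only [dilationKernel]
  rw [lintegral_const_mul _ (by fun_prop), lintegral_mul_const _ hm,
    lintegral_prod _ hm.aemeasurable]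
  have : ∀ θ : sphere (0 : E) 1, ∫⁻ t', W q ((ρ * ‖q.1‖) • (θ : E), t') ∂ν =
      C * ENNReal.ofReal (‖q.1 - (ρ * ‖q.1‖) • (θ : E)‖ ^ (-(finrank ℝ E : ℝ) - α)) :=
    fun θ => h1 q.1 _ (ne_smul_of_mem_sphere hq hρ hρ1 θ) q.2
  simp_rw [this]
  rw [lintegral_const_mul _ (by fun_prop), lintegral_sphere_norm_sub_rpow hη _ _ hq]
  have e : ENNReal.ofReal (‖q.1‖ ^ (-α)) =
      ENNReal.ofReal (‖q.1‖ ^ (-(finrank ℝ E : ℝ) - α)) *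
        ENNReal.ofReal (‖q.1‖ ^ finrank ℝ E) := by
    rw [← ENNReal.ofReal_mul (by positivity), ← Real.rpow_natCast, ← Real.rpow_add hq']
    congr 2; ring
  rw [ENNReal.ofReal_mul (by positivity), e]
  ring

/-- With `z = rφ`, the value of `u` depends on `r`, `θ`, `t'` only, so `t` and `φ` are integrated
out. The remaining `r` and `θ` are polar coordinates of a new point, and dilating it by `ρ` produces
`ρ^(α-N)`. -/
theorem lintegral_snd_dilationKernel [Nontrivial E] (hW : Measurable (Function.uncurry W))
    (h2 : ∀ z z', z ≠ z' → ∀ t', ∫⁻ t, W (z, t) (z', t') ∂ν =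
      C * ENNReal.ofReal (‖z - z'‖ ^ (-(finrank ℝ E : ℝ) - α)))
    {η : E} (hη : ‖η‖ = 1) {ρ : ℝ} (hρ : 0 < ρ) (hρ1 : ρ ≠ 1)
    (u : E × T → ℝ≥0∞) (hu : Measurable u) :
    ∫⁻ x, u ((ρ * ‖x.1.1‖) • (x.2.1 : E), x.2.2) * dilationKernel W ρ x
        ∂(((volume : Measure E).prod ν).prod ((volume : Measure E).toSphere.prod ν)) =
      ENNReal.ofReal (ρ ^ (α - finrank ℝ E)) *
        (C * ENNReal.ofReal (ρ ^ (finrank ℝ E - 1)) *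
        sphereKernel η (-(finrank ℝ E : ℝ) - α) ρ *
        ∫⁻ q, ENNReal.ofReal (‖q.1‖ ^ (-α)) * u q ∂((volume : Measure E).prod ν)) := by
  have hd := measurable_dilationKernel hW ρ
  set K := C * ENNReal.ofReal (ρ ^ (finrank ℝ E - 1)) *
        sphereKernel η (-(finrank ℝ E : ℝ) - α) ρ with hK
  have hm1 : Measurable fun x : (E × T) × (sphere (0 : E) 1 × T) =>
      u ((ρ * ‖x.1.1‖) • (x.2.1 : E), x.2.2) :=
    hu.comp (f := fun x : (E × T) × (sphere (0 : E) 1 × T) =>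
      ((ρ * ‖x.1.1‖) • (x.2.1 : E), x.2.2)) (by fun_prop)
  have step : ∀ y : sphere (0 : E) 1 × T,
      ∫⁻ q, u ((ρ * ‖q.1‖) • (y.1 : E), y.2) * dilationKernel W ρ (q, y)
        ∂((volume : Measure E).prod ν) =
      ∫⁻ r in Ioi (0 : ℝ), ENNReal.ofReal (r ^ (finrank ℝ E - 1)) *
        (K * (ENNReal.ofReal (‖r • (y.1 : E)‖ ^ (-α)) * u (ρ • r • (y.1 : E), y.2))) := by
    intro y
    have hmW : Measurable fun q : E × T => W q ((ρ * ‖q.1‖) • (y.1 : E), y.2) :=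
      hW.comp (f := fun q : E × T => (q, ((ρ * ‖q.1‖) • (y.1 : E), y.2))) (by fun_prop)
    have hmu : Measurable fun z : E => u ((ρ * ‖z‖) • (y.1 : E), y.2) :=
      hu.comp (f := fun z : E => ((ρ * ‖z‖) • (y.1 : E), y.2)) (by fun_prop)
    rw [lintegral_prod _ (by fun_prop)]
    have : ∀ᵐ z : E, ∫⁻ t, u ((ρ * ‖z‖) • (y.1 : E), y.2) * dilationKernel W ρ ((z, t), y) ∂ν =
        u ((ρ * ‖z‖) • (y.1 : E), y.2) *
          (C * ENNReal.ofReal (‖z - (ρ * ‖z‖) • (y.1 : E)‖ ^ (-(finrank ℝ E : ℝ) - α)) *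
            ENNReal.ofReal (ρ ^ (finrank ℝ E - 1) * ‖z‖ ^ finrank ℝ E)) := by
      filter_upwards [Measure.ae_ne volume (0 : E)] with z hz
      have hmt : Measurable fun t : T => W (z, t) ((ρ * ‖z‖) • (y.1 : E), y.2) :=
        hmW.comp (f := fun t : T => (z, t)) (by fun_prop)
      simp only [dilationKernel]
      rw [lintegral_const_mul _ (by fun_prop), lintegral_mul_const _ hmt,
        h2 _ _ (ne_smul_of_mem_sphere hz hρ hρ1 y.1)]
    rw [lintegral_congr_ae this, lintegral_polar _ (by fun_prop)]
    refine setLIntegral_congr_fun measurableSet_Ioi fun r hr => ?_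
    have hr' : (0 : ℝ) < r := hr
    have hn : ∀ φ : sphere (0 : E) 1, ‖r • (φ : E)‖ = r := fun φ => by
      simp [norm_smul, abs_of_pos hr']
    simp only [hn]
    rw [lintegral_const_mul _ (by fun_prop), lintegral_mul_const _ (by fun_prop),
      lintegral_const_mul _ (by fun_prop), lintegral_sphere_norm_sub_rpow' hη _ _ hr']
    have e : ENNReal.ofReal (r ^ (-α)) =
        ENNReal.ofReal (r ^ (-(finrank ℝ E : ℝ) - α)) * ENNReal.ofReal (r ^ finrank ℝ E) := by
      rw [← ENNReal.ofReal_mul (by positivity), ← Real.rpow_natCast, ← Real.rpow_add hr']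
      congr 2; ring
    rw [ENNReal.ofReal_mul (by positivity), e, hK, smul_smul]
    ring
  have hmb : Measurable fun q : E × T => ENNReal.ofReal (‖q.1‖ ^ (-α)) * u (ρ • q.1, q.2) := by
    refine Measurable.mul (by fun_prop) ?_
    exact hu.comp (f := fun q : E × T => (ρ • q.1, q.2)) (by fun_prop)
  have hmb4 : Measurable fun s : (sphere (0 : E) 1 × T) × ℝ =>
      ENNReal.ofReal (s.2 ^ (finrank ℝ E - 1)) *
        (K * (ENNReal.ofReal (‖s.2 • (s.1.1 : E)‖ ^ (-α)) * u (ρ • s.2 • (s.1.1 : E), s.1.2))) :=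
    Measurable.mul (by fun_prop) (Measurable.const_mul (hmb.comp
      (f := fun s : (sphere (0 : E) 1 × T) × ℝ => (s.2 • (s.1.1 : E), s.1.2)) (by fun_prop)) K)
  rw [lintegral_prod_symm _ (by fun_prop), lintegral_congr step,
    lintegral_prod_symm _ (Measurable.lintegral_prod_right' hmb4).aemeasurable]
  -- Reassemble `rθ` into a point of `E`, then rescale: the weight contributes `ρ^α` and Lebesgue
  -- measure `ρ^(-N)`.
  have step2 : ∀ t : T, ∫⁻ θ : sphere (0 : E) 1, (∫⁻ r in Ioi (0 : ℝ),
      ENNReal.ofReal (r ^ (finrank ℝ E - 1)) *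
        (K * (ENNReal.ofReal (‖r • (θ : E)‖ ^ (-α)) * u (ρ • r • (θ : E), t))))
        ∂(volume : Measure E).toSphere =
      ENNReal.ofReal (ρ ^ (α - finrank ℝ E)) *
        (K * ∫⁻ z, ENNReal.ofReal (‖z‖ ^ (-α)) * u (z, t)) := by
    intro t
    have hmt : Measurable fun z : E => ENNReal.ofReal (‖z‖ ^ (-α)) * u (ρ • z, t) :=
      hmb.comp (f := fun z : E => (z, t)) (by fun_prop)
    have hut : Measurable fun z : E => u (z, t) :=
      hu.comp (f := fun z : E => (z, t)) (by fun_prop)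
    have sw : AEMeasurable (Function.uncurry fun (θ : sphere (0 : E) 1) (r : ℝ) =>
        ENNReal.ofReal (r ^ (finrank ℝ E - 1)) *
        (K * (ENNReal.ofReal (‖r • (θ : E)‖ ^ (-α)) * u (ρ • r • (θ : E), t))))
        ((volume : Measure E).toSphere.prod (volume.restrict (Ioi 0))) :=
      (hmb4.comp (f := fun s : sphere (0 : E) 1 × ℝ => ((s.1, t), s.2)) (by fun_prop)).aemeasurable
    rw [lintegral_lintegral_swap sw]
    have : ∀ r : ℝ, ∫⁻ θ : sphere (0 : E) 1, ENNReal.ofReal (r ^ (finrank ℝ E - 1)) *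
        (K * (ENNReal.ofReal (‖r • (θ : E)‖ ^ (-α)) * u (ρ • r • (θ : E), t)))
        ∂(volume : Measure E).toSphere = ENNReal.ofReal (r ^ (finrank ℝ E - 1)) *
        ∫⁻ θ : sphere (0 : E) 1,
        (K * (ENNReal.ofReal (‖r • (θ : E)‖ ^ (-α)) * u (ρ • r • (θ : E), t)))
        ∂(volume : Measure E).toSphere := fun r => by
      rw [lintegral_const_mul]
      exact (hmt.comp (f := fun θ : sphere (0 : E) 1 => r • (θ : E)) (by fun_prop)).const_mul K
    simp_rw [this]
    rw [← lintegral_polar (fun z : E => K * (ENNReal.ofReal (‖z‖ ^ (-α)) * u (ρ • z, t)))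
      (hmt.const_mul K), lintegral_const_mul _ hmt, mul_left_comm]
    congr 1
    have e : ∀ z : E, ENNReal.ofReal (‖z‖ ^ (-α)) * u (ρ • z, t) = ENNReal.ofReal (ρ ^ α) *
        (ENNReal.ofReal (‖ρ • z‖ ^ (-α)) * u (ρ • z, t)) := fun z => by
      rw [← mul_assoc, ← ENNReal.ofReal_mul (by positivity), norm_smul, Real.norm_eq_abs,
        abs_of_pos hρ, Real.mul_rpow hρ.le (norm_nonneg _), ← mul_assoc, ← Real.rpow_add hρ,
        add_neg_cancel, Real.rpow_zero, one_mul]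
    simp_rw [e]
    rw [lintegral_comp_smul (fun z : E => ENNReal.ofReal (ρ ^ α) *
        (ENNReal.ofReal (‖z‖ ^ (-α)) * u (z, t))) hρ, lintegral_const_mul _ (by fun_prop),
      ← mul_assoc, ← ENNReal.ofReal_mul (by positivity), ← Real.rpow_natCast,
      ← Real.rpow_neg hρ.le, ← Real.rpow_add hρ]
    congr 3
    ring
  simp_rw [step2]
  rw [lintegral_const_mul, lintegral_const_mul, lintegral_prod_symm]
  · fun_prop
  · exact Measurable.lintegral_prod_left' (f := fun q : E × T =>
      ENNReal.ofReal (‖q.1‖ ^ (-α)) * u q) (by fun_prop)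
  · exact (Measurable.lintegral_prod_left' (f := fun q : E × T =>
      ENNReal.ofReal (‖q.1‖ ^ (-α)) * u q) (by fun_prop)).const_mul K

/-- The sharp fractional Hardy inequality in the variable `z ∈ E`, for a kernel on `E × T` whose
marginals in both variables of `T` are the kernel `C ‖z - z'‖ ^ (-(dim E) - α)`. -/
theorem fractional_hardy_of_marginals [Nontrivial E] (hW : Measurable (Function.uncurry W))
    (hC : C ≠ ∞) (hα : 0 ≤ α)
    (h1 : ∀ z z', z ≠ z' → ∀ t, ∫⁻ t', W (z, t) (z', t') ∂ν =
      C * ENNReal.ofReal (‖z - z'‖ ^ (-(finrank ℝ E : ℝ) - α)))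
    (h2 : ∀ z z', z ≠ z' → ∀ t', ∫⁻ t, W (z, t) (z', t') ∂ν =
      C * ENNReal.ofReal (‖z - z'‖ ^ (-(finrank ℝ E : ℝ) - α)))
    {p : ℝ} (hp : 1 ≤ p) {η : E} (hη : ‖η‖ = 1) (f : E × T → ℂ) (hf : Measurable f)
    (hS : ∫⁻ q, ENNReal.ofReal (‖q.1‖ ^ (-α)) * ‖f q‖ₑ ^ p ∂((volume : Measure E).prod ν) ≠ ∞) :
    C * (∫⁻ x : E, ENNReal.ofReal (|1 - ‖x‖ ^ (-((finrank ℝ E - α) / p))| ^ p *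
        ‖x - η‖ ^ (-(finrank ℝ E : ℝ) - α))) *
      ∫⁻ q, ENNReal.ofReal (‖q.1‖ ^ (-α)) * ‖f q‖ₑ ^ p ∂((volume : Measure E).prod ν) ≤
    ∫⁻ q, ∫⁻ q', ‖f q - f q'‖ₑ ^ p * W q q' ∂(volume.prod ν) ∂((volume : Measure E).prod ν) := by
  have hp0 : 0 < p := by linarith
  set S := ∫⁻ q, ENNReal.ofReal (‖q.1‖ ^ (-α)) * ‖f q‖ₑ ^ p ∂((volume : Measure E).prod ν) with hSd
  set Φ := sphereKernel η (-(finrank ℝ E : ℝ) - α) with hΦ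
  have hG : Measurable (Function.uncurry fun q q' : E × T => ‖f q - f q'‖ₑ ^ p * W q q') := by
    refine Measurable.mul ?_ hW
    change Measurable fun x : (E × T) × (E × T) => ‖f x.1 - f x.2‖ₑ ^ p
    fun_prop
  rw [lintegral_lintegral_dilation ν _ hG, lintegral_polar _ (by fun_prop),
    ← lintegral_const_mul' _ _ hC, ← lintegral_mul_const' _ _ hS]
  refine lintegral_mono_ae ?_
  -- The slice `ρ = 1` is discarded because the finiteness of `M` is available only for `ρ ≠ 1`.
  filter_upwards [ae_restrict_mem measurableSet_Ioi,
    ae_restrict_of_ae (Measure.ae_ne volume (1 : ℝ))] with ρ hρ hρ1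
  have hρ' : (0 : ℝ) < ρ := hρ
  have hn : ∀ φ : sphere (0 : E) 1, ‖ρ • (φ : E)‖ = ρ := fun φ => by
    simp [norm_smul, abs_of_pos hρ']
  set M := C * ENNReal.ofReal (ρ ^ (finrank ℝ E - 1)) * Φ ρ * S with hM
  have hMt : M ≠ ∞ := by
    refine ENNReal.mul_ne_top (ENNReal.mul_ne_top (ENNReal.mul_ne_top hC ENNReal.ofReal_ne_top) ?_) hS
    exact sphereKernel_ne_top hη (by
      have : (0 : ℝ) ≤ finrank ℝ E := by positivity
      linarith) hρ' hρ1
  have hm : 0 ≤ ρ ^ (-((finrank ℝ E - α) / p)) := by positivity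
  -- The exponent `(N - α) / p` is exactly the one for which the second norm is `m = ρ^(-(N-α)/p)`
  -- times the first.
  have em : (ρ ^ (-((finrank ℝ E - α) / p))) ^ p = ρ ^ (α - finrank ℝ E) := by
    rw [← Real.rpow_mul hρ'.le]
    congr 1
    field_simp
    ring
  have eL : C * (ENNReal.ofReal (ρ ^ (finrank ℝ E - 1)) * ∫⁻ θ : sphere (0 : E) 1,
      ENNReal.ofReal (|1 - ‖ρ • (θ : E)‖ ^ (-((finrank ℝ E - α) / p))| ^ p *
        ‖ρ • (θ : E) - η‖ ^ (-(finrank ℝ E : ℝ) - α)) ∂(volume : Measure E).toSphere) * S =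
      ENNReal.ofReal (|1 - ρ ^ (-((finrank ℝ E - α) / p))| ^ p) * M := by
    simp only [hn]
    have : ∀ θ : sphere (0 : E) 1, ENNReal.ofReal (|1 - ρ ^ (-((finrank ℝ E - α) / p))| ^ p *
        ‖ρ • (θ : E) - η‖ ^ (-(finrank ℝ E : ℝ) - α)) =
        ENNReal.ofReal (|1 - ρ ^ (-((finrank ℝ E - α) / p))| ^ p) *
        ENNReal.ofReal (‖η - ρ • (θ : E)‖ ^ (-(finrank ℝ E : ℝ) - α)) := fun θ => by
      rw [norm_sub_rev, ENNReal.ofReal_mul (by positivity)]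
    simp_rw [this]
    rw [lintegral_const_mul _ (by fun_prop), hM, hΦ, sphereKernel]
    ring
  rw [eL]
  have hu : Measurable fun q => ‖f q‖ₑ ^ p := by fun_prop
  have m1 := lintegral_fst_dilationKernel hW h1 hη hρ' hρ1 _ hu
  have m2 := lintegral_snd_dilationKernel hW h2 hη hρ' hρ1 _ hu
  rw [← hSd, ← hΦ, ← hM] at m1 m2
  rw [← em] at m2
  have hd := measurable_dilationKernel hW ρ
  have hB : Measurable fun x : (E × T) × (sphere (0 : E) 1 × T) =>
      f ((ρ * ‖x.1.1‖) • (x.2.1 : E), x.2.2) :=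
    hf.comp (f := fun x : (E × T) × (sphere (0 : E) 1 × T) =>
      ((ρ * ‖x.1.1‖) • (x.2.1 : E), x.2.2)) (by fun_prop)
  have hA : Measurable fun x : (E × T) × (sphere (0 : E) 1 × T) => f x.1 := by fun_prop
  have hD : Measurable fun x : (E × T) × (sphere (0 : E) 1 × T) =>
      ‖f x.1 - f ((ρ * ‖x.1.1‖) • (x.2.1 : E), x.2.2)‖ₑ := by fun_prop
  simp only [mul_assoc]
  change _ ≤ ∫⁻ x, ‖f x.1 - f ((ρ * ‖x.1.1‖) • (x.2.1 : E), x.2.2)‖ₑ ^ p *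
    dilationKernel W ρ x ∂_
  apply ENNReal.abs_one_sub_rpow_mul_le hp hm hMt
  · rw [← m2, ← m1]
    refine ENNReal.le_lintegral_Lp_sub _ hp _ _ _ _ hd hB.enorm hD fun x => ?_
    rw [add_comm]
    simpa using enorm_add_le (f x.1 - f ((ρ * ‖x.1.1‖) • (x.2.1 : E), x.2.2))
      (f ((ρ * ‖x.1.1‖) • (x.2.1 : E), x.2.2))
  · rw [← m2, ← m1]
    refine ENNReal.le_lintegral_Lp_sub _ hp _ _ _ _ hd hA.enorm hD fun x => ?_
    simpa using enorm_sub_le (a := f x.1) (b := f x.1 - f ((ρ * ‖x.1.1‖) • (x.2.1 : E), x.2.2))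

end Hardy

/-! ### The Beta integral for the central variable -/

section Beta

theorem lintegral_rpow_mul_exp_neg_mul_Ioi {a r : ℝ} (ha : 0 < a) (hr : 0 < r) :
    ∫⁻ x in Ioi (0 : ℝ), ENNReal.ofReal (x ^ (a - 1) * Real.exp (-(r * x))) =
      ENNReal.ofReal (r ^ (-a) * Real.Gamma a) := by
  have hI : IntegrableOn (fun x : ℝ => x ^ (a - 1) * Real.exp (-(r * x))) (Ioi 0) := by
    -- A non-integrable function would have Bochner integral `0`, but the known value is positive.
    by_contra h
    have h1 := Real.integral_rpow_mul_exp_neg_mul_Ioi ha hr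
    rw [integral_undef h] at h1
    have : 0 < (1 / r) ^ a * Real.Gamma a :=
      mul_pos (Real.rpow_pos_of_pos (by positivity) _) (Real.Gamma_pos_of_pos ha)
    linarith
  rw [← ofReal_integral_eq_lintegral_ofReal hI, Real.integral_rpow_mul_exp_neg_mul_Ioi ha hr,
    one_div, Real.inv_rpow hr.le, Real.rpow_neg hr.le]
  filter_upwards [ae_restrict_mem measurableSet_Ioi] with x hx
  have : (0 : ℝ) < x := hx
  positivity

/-- Write `Γ(s) (1 + u²)^(-s)` as the integral of `x^(s-1) e^(-(1+u²)x)` over `x > 0` and exchange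
the integrals: the Gaussian in `u` gives `√(π/x)`, leaving `√π Γ(s - 1/2)`. -/
theorem lintegral_one_add_sq_rpow {s : ℝ} (hs : 1 / 2 < s) :
    ∫⁻ u : ℝ, ENNReal.ofReal ((1 + u ^ 2) ^ (-s)) =
      ENNReal.ofReal (√Real.pi * Real.Gamma (s - 1 / 2) / Real.Gamma s) := by
  have hs0 : 0 < s := by linarith
  have hG : 0 < Real.Gamma s := Real.Gamma_pos_of_pos hs0
  have hG0 : ENNReal.ofReal (Real.Gamma s) ≠ 0 := by simpa using hG
  rw [← ENNReal.mul_right_inj hG0 ENNReal.ofReal_ne_top, ← ENNReal.ofReal_mul hG.le,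
    mul_div_cancel₀ _ hG.ne', ← lintegral_const_mul _ (by fun_prop)]
  have h1 : ∀ u : ℝ, ENNReal.ofReal (Real.Gamma s) * ENNReal.ofReal ((1 + u ^ 2) ^ (-s)) =
      ∫⁻ x in Ioi (0 : ℝ), ENNReal.ofReal (x ^ (s - 1) * Real.exp (-((1 + u ^ 2) * x))) :=
    fun u => by
      rw [lintegral_rpow_mul_exp_neg_mul_Ioi hs0 (by positivity), ← ENNReal.ofReal_mul hG.le,
        mul_comm]
  simp_rw [h1]
  rw [lintegral_lintegral_swap (Measurable.aemeasurable (by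
    change Measurable fun y : ℝ × ℝ =>
      ENNReal.ofReal (y.2 ^ (s - 1) * Real.exp (-((1 + y.1 ^ 2) * y.2)))
    fun_prop))]
  have h2 : ∀ x ∈ Ioi (0 : ℝ),
      ∫⁻ u : ℝ, ENNReal.ofReal (x ^ (s - 1) * Real.exp (-((1 + u ^ 2) * x))) =
      ENNReal.ofReal √Real.pi * ENNReal.ofReal (x ^ (s - 1 / 2 - 1) * Real.exp (-(1 * x))) := by
    intro x hx
    have hx' : (0 : ℝ) < x := hx
    have h3 : ∀ u : ℝ, ENNReal.ofReal (x ^ (s - 1) * Real.exp (-((1 + u ^ 2) * x))) =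
        ENNReal.ofReal (x ^ (s - 1) * Real.exp (-x)) * ENNReal.ofReal (Real.exp (-x * u ^ 2)) :=
      fun u => by
        rw [← ENNReal.ofReal_mul (by positivity), mul_assoc, ← Real.exp_add]
        congr 3
        ring
    simp_rw [h3]
    rw [lintegral_const_mul _ (by fun_prop),
      ← ofReal_integral_eq_lintegral_ofReal (integrable_exp_neg_mul_sq hx')
        (Filter.Eventually.of_forall fun u => by positivity), integral_gaussian,
      ← ENNReal.ofReal_mul (by positivity), ← ENNReal.ofReal_mul (by positivity)]
    congr 1
    rw [Real.sqrt_div Real.pi_pos.le, Real.sqrt_eq_rpow x,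
      show s - 1 / 2 - 1 = s - 1 - 1 / 2 by ring, Real.rpow_sub hx' (s - 1), one_mul]
    ring
  rw [setLIntegral_congr_fun measurableSet_Ioi h2, lintegral_const_mul _ (by fun_prop),
    lintegral_rpow_mul_exp_neg_mul_Ioi (by linarith) one_pos, ← ENNReal.ofReal_mul (by positivity)]
  simp

theorem lintegral_pow_four_add_sq_rpow {s a : ℝ} (hs : 1 / 2 < s) (ha : 0 < a) :
    ∫⁻ u : ℝ, ENNReal.ofReal ((a ^ 4 + u ^ 2) ^ (-s)) =
      ENNReal.ofReal (√Real.pi * Real.Gamma (s - 1 / 2) / Real.Gamma s) *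
        ENNReal.ofReal (a ^ (2 - 4 * s)) := by
  have h := lintegral_comp_smul (fun u : ℝ => ENNReal.ofReal ((a ^ 4 + u ^ 2) ^ (-s)))
    (r := a ^ 2) (by positivity)
  have e : ∀ u : ℝ, ENNReal.ofReal ((a ^ 4 + (a ^ 2 • u) ^ 2) ^ (-s)) =
      ENNReal.ofReal (a ^ (-4 * s)) * ENNReal.ofReal ((1 + u ^ 2) ^ (-s)) := fun u => by
    rw [← ENNReal.ofReal_mul (by positivity)]
    congr 1
    rw [show a ^ 4 + (a ^ 2 • u) ^ 2 = a ^ 4 * (1 + u ^ 2) by rw [smul_eq_mul]; ring,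
      Real.mul_rpow (by positivity) (by positivity), ← Real.rpow_natCast, ← Real.rpow_mul ha.le]
    norm_num
  simp_rw [e] at h
  rw [lintegral_const_mul _ (by fun_prop), lintegral_one_add_sq_rpow hs, finrank_self, pow_one] at h
  have h2 : ENNReal.ofReal (a ^ 2) * ENNReal.ofReal ((a ^ 2)⁻¹) = 1 := by
    rw [← ENNReal.ofReal_mul (by positivity), mul_inv_cancel₀ (by positivity), ENNReal.ofReal_one]
  rw [← one_mul (lintegral _ _), ← h2, mul_assoc, ← h, ← mul_assoc,
    ← ENNReal.ofReal_mul (by positivity), mul_comm, ← Real.rpow_natCast, ← Real.rpow_add ha]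
  congr 3
  push_cast
  ring

end Beta

/-! ### Finiteness of the Hardy integral -/

section Decay

variable {E : Type*} [NormedAddCommGroup E] [InnerProductSpace ℝ E] [FiniteDimensional ℝ E]
  [MeasurableSpace E] [BorelSpace E]

/-- The singularity is integrable on the unit ball since `α < N`; outside it `‖z‖^(-α) ≤ 1`, and
decay of order `N + 1` suffices. -/
theorem lintegral_norm_rpow_mul_one_add_norm_rpow_lt_top [Nontrivial E] {α : ℝ} (hα : 0 ≤ α)
    (hαN : α < finrank ℝ E) :
    ∫⁻ z : E, ENNReal.ofReal (‖z‖ ^ (-α) * (1 + ‖z‖) ^ (-((finrank ℝ E : ℝ) + 1))) < ∞ := by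
  have hN : 0 < finrank ℝ E := finrank_pos
  have i1 : IntegrableOn (fun z : E => ‖z‖ ^ (-α)) (ball 0 1) := by
    rw [integrableOn_fun_norm_addHaar volume (f := fun y : ℝ => y ^ (-α))]
    have : IntegrableOn (fun y : ℝ => y ^ ((finrank ℝ E : ℝ) - 1 - α)) (Ioo 0 1) :=
      (intervalIntegral.intervalIntegrable_rpow' (by linarith)).1.mono_set Ioo_subset_Ioc_self
    refine this.congr_fun (fun y hy => ?_) measurableSet_Ioo
    simp only [smul_eq_mul]
    rw [← Real.rpow_natCast, ← Real.rpow_add hy.1, Nat.cast_pred hN]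
    congr 1
  have i2 : Integrable (fun z : E => (1 + ‖z‖) ^ (-((finrank ℝ E : ℝ) + 1))) :=
    integrable_one_add_norm (by linarith)
  refine lt_of_le_of_lt ?_ ((i1.integrable_indicator measurableSet_ball).add i2).lintegral_lt_top
  refine lintegral_mono fun z => ENNReal.ofReal_le_ofReal ?_
  have hb0 : 0 ≤ (1 + ‖z‖) ^ (-((finrank ℝ E : ℝ) + 1)) := by positivity
  simp only [Pi.add_apply]
  by_cases hz : ‖z‖ < 1
  · have hb1 : (1 + ‖z‖) ^ (-((finrank ℝ E : ℝ) + 1)) ≤ 1 :=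
      Real.rpow_le_one_of_one_le_of_nonpos (by linarith [norm_nonneg z]) (by linarith)
    rw [indicator_of_mem (by simpa using hz)]
    have : 0 ≤ ‖z‖ ^ (-α) := by positivity
    nlinarith
  · rw [indicator_of_notMem (by simpa using hz), zero_add]
    have : ‖z‖ ^ (-α) ≤ 1 :=
      Real.rpow_le_one_of_one_le_of_nonpos (not_lt.1 hz) (by linarith)
    nlinarith

theorem lintegral_norm_rpow_mul_rpow_ne_top [Nontrivial E] {α p A : ℝ} (hα : 0 ≤ α)
    (hαN : α < finrank ℝ E) (hp : 1 ≤ p) (f : E × ℝ → ℂ)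
    (hf : ∀ q, (1 + ‖q‖) ^ (finrank ℝ E + 1 + 2) * ‖f q‖ ≤ A) :
    ∫⁻ q, ENNReal.ofReal (‖q.1‖ ^ (-α)) * ‖f q‖ₑ ^ p ∂((volume : Measure E).prod volume) ≠ ∞ := by
  have hp0 : 0 ≤ p := by linarith
  have hA : 0 ≤ A := le_trans (by positivity) (hf 0)
  have bound : ∀ q : E × ℝ, ENNReal.ofReal (‖q.1‖ ^ (-α)) * ‖f q‖ₑ ^ p ≤
      ENNReal.ofReal (A ^ p) *
      (ENNReal.ofReal (‖q.1‖ ^ (-α) * (1 + ‖q.1‖) ^ (-((finrank ℝ E : ℝ) + 1))) *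
        ENNReal.ofReal ((1 + ‖q.2‖) ^ (-2 : ℝ))) := fun q => by
    rw [← ofReal_norm, ENNReal.ofReal_rpow_of_nonneg (norm_nonneg _) hp0,
      ← ENNReal.ofReal_mul (by positivity), ← ENNReal.ofReal_mul (by positivity),
      ← ENNReal.ofReal_mul (by positivity)]
    refine ENNReal.ofReal_le_ofReal ?_
    -- The decay order `N + 1 + 2` is split as `N + 1` in `z` and `2` in `t`. As `b ≤ 1` and `p ≥
    -- 1`, `b^p ≤ b`.
    set b : ℝ := (1 + ‖q.1‖) ^ (-((finrank ℝ E : ℝ) + 1)) * (1 + ‖q.2‖) ^ (-2 : ℝ) with hb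
    have hb0 : 0 ≤ b := by positivity
    have hb1 : b ≤ 1 := mul_le_one₀
      (Real.rpow_le_one_of_one_le_of_nonpos (by linarith [norm_nonneg q.1])
        (by linarith [(finrank ℝ E).cast_nonneg (α := ℝ)])) (by positivity)
      (Real.rpow_le_one_of_one_le_of_nonpos (by linarith [norm_nonneg q.2]) (by norm_num))
    have hfb : ‖f q‖ ≤ A * b := by
      have e : b = ((1 + ‖q.1‖) ^ (finrank ℝ E + 1) * (1 + ‖q.2‖) ^ 2)⁻¹ := by
        rw [hb, Real.rpow_neg (by positivity), Real.rpow_neg (by positivity), mul_inv]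
        norm_cast
      rw [e, ← div_eq_mul_inv, le_div_iff₀ (by positivity), mul_comm]
      refine le_trans (mul_le_mul_of_nonneg_right ?_ (norm_nonneg _)) (hf q)
      rw [pow_add _ (finrank ℝ E + 1) 2]
      gcongr
      · exact norm_fst_le q
      · exact norm_snd_le q
    calc ‖q.1‖ ^ (-α) * ‖f q‖ ^ p ≤ ‖q.1‖ ^ (-α) * (A ^ p * b) := by
          gcongr
          calc ‖f q‖ ^ p ≤ (A * b) ^ p := Real.rpow_le_rpow (norm_nonneg _) hfb hp0
            _ = A ^ p * b ^ p := Real.mul_rpow hA hb0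
            _ ≤ A ^ p * b := by
              gcongr
              simpa using Real.rpow_le_rpow_of_exponent_ge_of_imp hb0 hb1 hp (by intros; linarith)
      _ = _ := by rw [hb]; ring
  refine ne_top_of_le_ne_top ?_ (lintegral_mono bound)
  rw [lintegral_const_mul _ (by fun_prop), lintegral_prod_mul
    (f := fun z : E => ENNReal.ofReal (‖z‖ ^ (-α) * (1 + ‖z‖) ^ (-((finrank ℝ E : ℝ) + 1))))
    (g := fun t : ℝ => ENNReal.ofReal ((1 + ‖t‖) ^ (-2 : ℝ))) (by fun_prop) (by fun_prop)]
  refine ENNReal.mul_ne_top ENNReal.ofReal_ne_top (ENNReal.mul_ne_top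
    (lintegral_norm_rpow_mul_one_add_norm_rpow_lt_top hα hαN).ne ?_)
  exact (integrable_one_add_norm (by simp)).lintegral_lt_top.ne

end Decay

/-! ### The Heisenberg distance kernel and its marginals -/

namespace Heisenberg

theorem d_eq {n : ℕ} (w w' : Heisenberg n) :
    d w w' = (‖w.z - w'.z‖ ^ 4 + (w.t - w'.t - 2 * imForm w'.z w.z) ^ 2) ^ (1 / 4 : ℝ) := by
  change (‖-w'.z + w.z‖ ^ 4 + (-w'.t + w.t + 2 * imForm (-w'.z) w.z) ^ 2) ^ (1 / 4 : ℝ) = _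
  have : imForm (-w'.z) w.z = -imForm w'.z w.z := by simp [imForm]
  rw [this, neg_add_eq_sub]
  congr 3
  ring

theorem measurable_imForm (n : ℕ) :
    Measurable fun x : EuclideanSpace ℂ (Fin n) × EuclideanSpace ℂ (Fin n) => imForm x.1 x.2 := by
  unfold imForm
  refine Continuous.measurable ?_
  fun_prop

/-- The kernel `d(w, w') ^ (-4 s)`. -/
noncomputable def distKernel (n : ℕ) (s : ℝ) (q q' : EuclideanSpace ℂ (Fin n) × ℝ) : ℝ≥0∞ :=
  ENNReal.ofReal ((‖q.1 - q'.1‖ ^ 4 + (q.2 - q'.2 - 2 * imForm q'.1 q.1) ^ 2) ^ (-s))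

theorem measurable_distKernel (n : ℕ) (s : ℝ) :
    Measurable (Function.uncurry (distKernel n s)) := by
  have h : Measurable fun x : (EuclideanSpace ℂ (Fin n) × ℝ) × (EuclideanSpace ℂ (Fin n) × ℝ) =>
      imForm x.2.1 x.1.1 :=
    (measurable_imForm n).comp (f := fun x : (EuclideanSpace ℂ (Fin n) × ℝ) ×
      (EuclideanSpace ℂ (Fin n) × ℝ) => (x.2.1, x.1.1)) (by fun_prop)
  change Measurable fun x : (EuclideanSpace ℂ (Fin n) × ℝ) × (EuclideanSpace ℂ (Fin n) × ℝ) =>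
    ENNReal.ofReal ((‖x.1.1 - x.2.1‖ ^ 4 + (x.1.2 - x.2.2 - 2 * imForm x.2.1 x.1.1) ^ 2) ^ (-s))
  fun_prop

theorem lintegral_distKernel_right {n : ℕ} {s : ℝ} (hs : 1 / 2 < s)
    (z z' : EuclideanSpace ℂ (Fin n)) (hz : z ≠ z') (t : ℝ) :
    ∫⁻ t', distKernel n s (z, t) (z', t') =
      ENNReal.ofReal (√Real.pi * Real.Gamma (s - 1 / 2) / Real.Gamma s) *
        ENNReal.ofReal (‖z - z'‖ ^ (2 - 4 * s)) := by
  rw [← lintegral_pow_four_add_sq_rpow hs (norm_pos_iff.2 (sub_ne_zero.2 hz)),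
    -- For fixed `z`, `z'` the twist is a constant, absorbed by a translation in the central
    -- variable.
    ← lintegral_sub_left_eq_self _ (t - 2 * imForm z' z)]
  refine lintegral_congr fun u => ?_
  simp only [distKernel]
  congr 4
  ring

theorem lintegral_distKernel_left {n : ℕ} {s : ℝ} (hs : 1 / 2 < s)
    (z z' : EuclideanSpace ℂ (Fin n)) (hz : z ≠ z') (t' : ℝ) :
    ∫⁻ t, distKernel n s (z, t) (z', t') =
      ENNReal.ofReal (√Real.pi * Real.Gamma (s - 1 / 2) / Real.Gamma s) *
        ENNReal.ofReal (‖z - z'‖ ^ (2 - 4 * s)) := by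
  rw [← lintegral_pow_four_add_sq_rpow hs (norm_pos_iff.2 (sub_ne_zero.2 hz)),
    ← lintegral_sub_right_eq_self
      (fun u : ℝ => ENNReal.ofReal ((‖z - z'‖ ^ 4 + u ^ 2) ^ (-s))) (t' + 2 * imForm z' z)]
  refine lintegral_congr fun u => ?_
  simp only [distKernel]
  congr 4
  ring

theorem ofReal_div_d_rpow {n : ℕ} (p s : ℝ) (hp : 0 ≤ p) (f : Heisenberg n → ℂ)
    (w w' : Heisenberg n) :
    ENNReal.ofReal (‖f w - f w'‖ ^ p / d w w' ^ (4 * s)) =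
      ‖f w - f w'‖ₑ ^ p * distKernel n s w w' := by
  rw [← ofReal_norm, ENNReal.ofReal_rpow_of_nonneg (norm_nonneg _) hp]
  change _ = _ * ENNReal.ofReal ((‖w.z - w'.z‖ ^ 4 +
    (w.t - w'.t - 2 * imForm w'.z w.z) ^ 2) ^ (-s))
  rw [← ENNReal.ofReal_mul (by positivity), d_eq, ← Real.rpow_mul (by positivity), div_eq_mul_inv]
  congr 2
  rw [Real.rpow_neg (by positivity)]
  congr 2
  ring

end Heisenberg

/-! ### Transfer of the constant from `ℝ²ⁿ` to `ℂⁿ`, and assembly -/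

theorem lintegral_comp_norm_sub_eq_of_finrank_eq {E F : Type*} [NormedAddCommGroup E]
    [InnerProductSpace ℝ E] [FiniteDimensional ℝ E] [MeasurableSpace E] [BorelSpace E]
    [NormedAddCommGroup F] [InnerProductSpace ℝ F] [FiniteDimensional ℝ F] [MeasurableSpace F]
    [BorelSpace F] (h : finrank ℝ E = finrank ℝ F) (η : F) :
    ∃ ξ : E, ‖ξ‖ = ‖η‖ ∧ ∀ g : ℝ → ℝ → ℝ≥0∞,
      ∫⁻ x : E, g ‖x‖ ‖x - ξ‖ = ∫⁻ y : F, g ‖y‖ ‖y - η‖ := by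
  let R : E ≃ₗᵢ[ℝ] F := (stdOrthonormalBasis ℝ E).equiv (stdOrthonormalBasis ℝ F) (finCongr h)
  refine ⟨R.symm η, R.symm.norm_map η, fun g => ?_⟩
  rw [← R.measurePreserving.lintegral_comp_emb R.toHomeomorph.measurableEmbedding]
  refine lintegral_congr fun x => ?_
  rw [R.norm_map, ← R.norm_map (x - R.symm η), map_sub, R.apply_symm_apply]

theorem theorem8 (n : ℕ) (p β : ℝ) (hβ0 : 0 < β) (hβ1 : β < 1) (hp1 : 1 ≤ p)
    (hp2 : p < 2 * n / β) (f : SchwartzMap (Heisenberg n) ℂ)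
    (η : EuclideanSpace ℝ (Fin (2 * n))) (hη : ‖η‖ = 1) :
    Heisenberg.constF n p β η *
        ∫⁻ w, ENNReal.ofReal (‖w.z‖ ^ (-(p * β)) * ‖f w‖ ^ p) ∂(Heisenberg.haar n) ≤
      ∫⁻ q : Heisenberg n × Heisenberg n,
        ENNReal.ofReal
          (‖f q.1 - f q.2‖ ^ p / Heisenberg.d q.1 q.2 ^ (2 * n + 2 + p * β))
        ∂((Heisenberg.haar n).prod (Heisenberg.haar n)) := by
  have hp0 : 0 ≤ p := by linarith
  have hα : 0 ≤ p * β := by positivity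
  have hαN : p * β < 2 * n := (lt_div_iff₀ hβ0).1 hp2
  have hfr : finrank ℝ (EuclideanSpace ℂ (Fin n)) = 2 * n := by
    rw [← finrank_mul_finrank ℝ ℂ (EuclideanSpace ℂ (Fin n)), Complex.finrank_real_complex,
      finrank_euclideanSpace_fin]
  have hfr' : (finrank ℝ (EuclideanSpace ℂ (Fin n)) : ℝ) = 2 * n := by rw [hfr]; push_cast; rfl
  -- `0 ≤ pβ < 2n` rules out `n = 0`.
  have hn : 0 < n := by
    have : (0 : ℝ) < n := by linarith
    exact_mod_cast this
  have : Nontrivial (EuclideanSpace ℂ (Fin n)) :=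
    nontrivial_of_finrank_pos (R := ℝ) (by omega)
  set s : ℝ := (2 * n + 2 + p * β) / 4 with hs
  have hs2 : 1 / 2 < s := by
    have : (1 : ℝ) ≤ n := by exact_mod_cast hn
    rw [hs]; linarith
  have e4 : (2 * n + 2 + p * β : ℝ) = 4 * s := by rw [hs]; ring
  have ee : 2 - 4 * s = -(finrank ℝ (EuclideanSpace ℂ (Fin n)) : ℝ) - p * β := by
    rw [hfr', hs]; ring
  obtain ⟨ξ, hξ, hint⟩ := lintegral_comp_norm_sub_eq_of_finrank_eq
    (E := EuclideanSpace ℂ (Fin n)) (by rw [hfr, finrank_euclideanSpace_fin]) η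
  let g : EuclideanSpace ℂ (Fin n) × ℝ → ℂ := f
  have hg : Measurable g := f.continuous.measurable
  -- Schwartz seminorm with polynomial weight of order `2n + 3` and no derivatives.
  have hdecay := fun q => f.one_add_le_sup_seminorm_apply (𝕜 := ℝ) (m := (2 * n + 1 + 2, 0))
    le_rfl le_rfl q
  simp only [norm_iteratedFDeriv_zero] at hdecay
  have hS := lintegral_norm_rpow_mul_rpow_ne_top hα (by rwa [hfr']) hp1 g
    (by rw [hfr]; exact hdecay)
  have main := fractional_hardy_of_marginals (Heisenberg.measurable_distKernel n s)
    ENNReal.ofReal_ne_top hα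
    (fun z z' hz t => by rw [← ee]; exact Heisenberg.lintegral_distKernel_right hs2 z z' hz t)
    (fun z z' hz t => by rw [← ee]; exact Heisenberg.lintegral_distKernel_left hs2 z z' hz t)
    hp1 (hξ.trans hη) g hg hS
  have hGm : Measurable fun x : (EuclideanSpace ℂ (Fin n) × ℝ) × (EuclideanSpace ℂ (Fin n) × ℝ) =>
      ‖g x.1 - g x.2‖ₑ ^ p * Heisenberg.distKernel n s x.1 x.2 :=
    Measurable.mul (by fun_prop) (Heisenberg.measurable_distKernel n s)
  rw [hfr', hint fun a b => ENNReal.ofReal (|1 - a ^ (-((2 * n - p * β) / p))| ^ p *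
    b ^ (-(2 * n) - p * β)), ← lintegral_prod (fun x : (EuclideanSpace ℂ (Fin n) × ℝ) ×
      (EuclideanSpace ℂ (Fin n) × ℝ) => ‖g x.1 - g x.2‖ₑ ^ p *
        Heisenberg.distKernel n s x.1 x.2) hGm.aemeasurable] at main
  have hR : ∫⁻ q : Heisenberg n × Heisenberg n,
        ENNReal.ofReal
          (‖f q.1 - f q.2‖ ^ p / Heisenberg.d q.1 q.2 ^ (2 * n + 2 + p * β))
        ∂((Heisenberg.haar n).prod (Heisenberg.haar n)) = 4 ^ n * (4 ^ n *
      ∫⁻ x, ‖g x.1 - g x.2‖ₑ ^ p * Heisenberg.distKernel n s x.1 x.2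
        ∂((volume : Measure (EuclideanSpace ℂ (Fin n))).prod (volume : Measure ℝ)).prod
          (volume.prod volume)) := by
    rw [e4]
    simp_rw [Heisenberg.ofReal_div_d_rpow p s hp0]
    rw [Heisenberg.haar, Measure.prod_smul_left, Measure.prod_smul_right, lintegral_smul_measure,
      lintegral_smul_measure]
    simp only [ENNReal.smul_def, smul_eq_mul, ENNReal.coe_pow, ENNReal.coe_ofNat]
    rfl
  have hL : ∫⁻ w, ENNReal.ofReal (‖w.z‖ ^ (-(p * β)) * ‖f w‖ ^ p) ∂(Heisenberg.haar n) =
      4 ^ n * ∫⁻ q, ENNReal.ofReal (‖q.1‖ ^ (-(p * β))) * ‖g q‖ₑ ^ p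
        ∂((volume : Measure (EuclideanSpace ℂ (Fin n))).prod (volume : Measure ℝ)) := by
    rw [Heisenberg.haar, lintegral_smul_measure]
    simp only [ENNReal.smul_def, smul_eq_mul, ENNReal.coe_pow, ENNReal.coe_ofNat]
    congr 1
    refine lintegral_congr fun w => ?_
    rw [← ofReal_norm, ENNReal.ofReal_rpow_of_nonneg (norm_nonneg _) hp0,
      ← ENNReal.ofReal_mul (Real.rpow_nonneg (norm_nonneg _) _)]
    rfl
  have hF : Heisenberg.constF n p β η =
      4 ^ n * (ENNReal.ofReal (√Real.pi * Real.Gamma (s - 1 / 2) / Real.Gamma s) *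
      ∫⁻ x : EuclideanSpace ℝ (Fin (2 * n)),
      ENNReal.ofReal
        (|1 - ‖x‖ ^ (-((2 * n - p * β) / p))| ^ p * ‖x - η‖ ^ (-(2 * n) - p * β))) := by
    rw [Heisenberg.constF, ← mul_assoc]
    congr 1
    rw [show s - 1 / 2 = (2 * n + p * β) / 4 by rw [hs]; ring, ← hs, mul_assoc, mul_div_assoc,
      ENNReal.ofReal_mul (by positivity)]
    congr 1
    rw [ENNReal.ofReal_pow (by norm_num)]
    norm_num
  -- The double integral carries `4^n` twice; on the other side one factor comes from `dw` and one
  -- from the constant.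
  rw [hR, hL, hF]
  rw [mul_assoc, mul_left_comm _ (4 ^ n)]
  gcongr
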